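/- Let $G$ be an abelian topological group, let $X$ be a compact space and let $\mu$ be a Borel measure on $X$. Assume that $G$ is Hausdorff, or that $X$ is Hausdorff and $\mu$ is regular. Let $L_1(X,\mu)$ be the space of ($\mu$-a.e. classes of) integrable complex-valued functions on $X$, and let $\tau_k(C(X))$ be the topology on $L_1(X,\mu)$ of uniform convergence on the norm-compact subsets of the Banach space $C(X)$ of continuous complex-valued functions on $X$, where $f\in L_1(X,\mu)$ acts on $C(X)$ by $g\mapsto\int_X fg\,d\mu$. Suppose that $G$ admits a uniform embedding into the additive topological group $(L_1(X,\mu),\tau_k(C(X)))$, that is, an injective map $T\colon G\to L_1(X,\mu)$ such that $T$ and $T^{-1}\colon T(G)\to G$ are uniformly continuous for the group uniformities. Then $G$ is unitarily representable, that is, $G$ is topologically isomorphic to a subgroup of the unitary group, with the strong operator topology, of some complex Hilbert space. -/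

import Mathlib

open MeasureTheory Topology

/-- The strong operator topology on the unitary group of a Hilbert space `H`: the topology of
pointwise convergence on `H`. -/
abbrev unitarySOT (H : Type*) [NormedAddCommGroup H] [InnerProductSpace ℂ H] [CompleteSpace H] :
    TopologicalSpace (unitary (H →L[ℂ] H)) :=
  TopologicalSpace.induced (fun U (ξ : H) => (U : H →L[ℂ] H) ξ) Pi.topologicalSpace

/-- A topological group is unitarily representable if it is topologically isomorphic to a subgroup
of the unitary group, with the strong operator topology, of some complex Hilbert space. -/
def IsUnitarilyRepresentable.{u} (G : Type u) [Group G] [TopologicalSpace G] : Prop :=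
  ∃ (H : Type u) (_ : NormedAddCommGroup H) (_ : InnerProductSpace ℂ H) (_ : CompleteSpace H)
    (π : G →* unitary (H →L[ℂ] H)), @IsEmbedding _ _ _ (unitarySOT H) π

section L1TauK

variable {X : Type*} [TopologicalSpace X] [CompactSpace X] [MeasurableSpace X] [BorelSpace X]

/-- `L1TauK μ` is the additive group `L₁(X, μ)` of complex functions, to be equipped with the
topology `τ_k(C(X))` instead of the norm topology. -/
def L1TauK (μ : Measure X) : Type _ := Lp ℂ 1 μ

noncomputable instance (μ : Measure X) : AddCommGroup (L1TauK μ) :=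
  inferInstanceAs (AddCommGroup (Lp ℂ 1 μ))

/-- The function `g ↦ ∫ f g dμ` on `C(X)` given by `f ∈ L₁(X, μ)`, as an element of the space of
functions on `C(X)` with the structure of uniform convergence on the compact subsets of the Banach
space `C(X)`. -/
noncomputable def L1TauK.pairing (μ : Measure X) (f : L1TauK μ) :
    UniformOnFun C(X, ℂ) ℂ {K : Set C(X, ℂ) | IsCompact K} :=
  UniformOnFun.ofFun _ fun g => ∫ x, (show Lp ℂ 1 μ from f) x * g x ∂μ

/-- The uniform structure of `(L₁(X, μ), τ_k(C(X)))`. -/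
noncomputable instance (μ : Measure X) : UniformSpace (L1TauK μ) :=
  UniformSpace.comap (L1TauK.pairing μ) inferInstance

theorem L1TauK.integrable_mul (μ : Measure X) (f : Lp ℂ 1 μ) (g : C(X, ℂ)) :
    Integrable (fun x => f x * g x) μ := by
  refine (L1.integrable_coeFn f).mul_bdd (c := ‖g‖) ?_ ?_
  · exact g.continuous.measurable.aestronglyMeasurable
  · exact Filter.Eventually.of_forall fun x => g.norm_coe_le_norm x

theorem L1TauK.pairing_add (μ : Measure X) (f₁ f₂ : L1TauK μ) :
    L1TauK.pairing μ (f₁ + f₂) = L1TauK.pairing μ f₁ + L1TauK.pairing μ f₂ := by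
  change UniformOnFun.ofFun _ _ = UniformOnFun.ofFun _ _
  congr 1
  funext g
  refine Eq.trans ?_ (integral_add (L1TauK.integrable_mul μ f₁ g) (L1TauK.integrable_mul μ f₂ g))
  refine integral_congr_ae ?_
  filter_upwards [Lp.coeFn_add (show Lp ℂ 1 μ from f₁) (show Lp ℂ 1 μ from f₂)] with x hx
  exact (congrArg (· * g x) hx).trans (add_mul _ _ _)

/-- The uniform structure of `L1TauK μ` is the one of a topological additive group. -/
instance (μ : Measure X) : IsUniformAddGroup (L1TauK μ) :=
  IsUniformAddGroup.comap (AddMonoidHom.mk' (L1TauK.pairing μ) (L1TauK.pairing_add μ))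

end L1TauK

theorem exists_almost_invariant_mean {G : Type*} [CommGroup G] (S : Finset G) {ε : ℝ}
    (hε : 0 < ε) :
    ∃ A : (G → ℝ) →ₗ[ℝ] ℝ, (∀ f, (∀ x, 0 ≤ f x) → 0 ≤ A f) ∧ A (fun _ => 1) = 1 ∧
      ∀ s ∈ S, ∀ (f : G → ℝ) (C : ℝ), (∀ x, |f x| ≤ C) →
        |A (fun x => f (s * x)) - A f| ≤ ε * C := by
  classical
  induction S using Finset.induction_on with
  | empty => exact ⟨LinearMap.proj 1, fun f hf => hf 1, rfl, by simp⟩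
  | insert a S _ ih =>
    obtain ⟨A, hpos, hone, hinv⟩ := ih
    have hbd : ∀ (f : G → ℝ) (C : ℝ), (∀ x, |f x| ≤ C) → |A f| ≤ C := by
      intro f C hf
      have hC : A (fun _ => C) = C := by
        have := A.map_smul C (fun _ => 1)
        rw [hone] at this
        simpa [Pi.smul_def] using this
      have h1 := hpos ((fun _ => C) - f) fun x => by simpa using (abs_le.1 (hf x)).2
      have h2 := hpos ((fun _ => C) + f) fun x => by
        have := (abs_le.1 (hf x)).1
        simp only [Pi.add_apply]
        linarith
      rw [map_sub, hC] at h1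
      rw [map_add, hC] at h2
      exact abs_le.2 ⟨by linarith, by linarith⟩
    obtain ⟨n, hn⟩ := exists_nat_gt (2 / ε)
    have hn0 : (0 : ℝ) < n := lt_trans (by positivity) hn
    have hn1 : (n : ℝ)⁻¹ * n = 1 := inv_mul_cancel₀ hn0.ne'
    let L : (G → ℝ) →ₗ[ℝ] (G → ℝ) :=
      (n : ℝ)⁻¹ • ∑ i ∈ Finset.range n, LinearMap.funLeft ℝ ℝ (fun x => a ^ i * x)
    have hL : ∀ f x, L f x = (n : ℝ)⁻¹ * ∑ i ∈ Finset.range n, f (a ^ i * x) := by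
      intro f x
      simp [L, LinearMap.funLeft_apply]
    have hLbd : ∀ (f : G → ℝ) (C : ℝ), (∀ x, |f x| ≤ C) → ∀ x, |L f x| ≤ C := by
      intro f C hf x
      rw [hL, abs_mul, abs_of_pos (inv_pos.2 hn0)]
      calc (n : ℝ)⁻¹ * |∑ i ∈ Finset.range n, f (a ^ i * x)|
          ≤ (n : ℝ)⁻¹ * ∑ i ∈ Finset.range n, C := by
            gcongr
            exact (Finset.abs_sum_le_sum_abs _ _).trans (Finset.sum_le_sum fun i _ => hf _)
        _ = C := by rw [Finset.sum_const, Finset.card_range, nsmul_eq_mul, ← mul_assoc, hn1,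
                      one_mul]
    refine ⟨A ∘ₗ L, fun f hf => hpos _ fun x => ?_, ?_, fun s hs f C hf => ?_⟩
    · rw [hL]
      exact mul_nonneg (inv_nonneg.2 hn0.le) (Finset.sum_nonneg fun i _ => hf _)
    · have : L (fun _ => 1) = fun _ => 1 := by
        funext x
        rw [hL]
        simpa using hn1
      rw [LinearMap.comp_apply, this, hone]
    · rw [LinearMap.comp_apply, LinearMap.comp_apply]
      have hC : 0 ≤ C := (abs_nonneg _).trans (hf 1)
      rcases Finset.mem_insert.1 hs with rfl | hs
      · rw [← map_sub]
        refine (hbd _ (2 / n * C) fun x => ?_).trans ?_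
        · have : (L (fun x => f (s * x)) - L f) x = (n : ℝ)⁻¹ * (f (s ^ n * x) - f x) := by
            rw [Pi.sub_apply, hL, hL, ← mul_sub, ← Finset.sum_sub_distrib]
            have := Finset.sum_range_sub (fun i => f (s ^ i * x)) n
            simp only [pow_zero, one_mul] at this
            rw [← this]
            simp only [pow_succ', mul_assoc]
          rw [this, abs_mul, abs_of_pos (inv_pos.2 hn0), div_eq_inv_mul, mul_assoc]
          gcongr
          calc |f (s ^ n * x) - f x| ≤ |f (s ^ n * x)| + |f x| := abs_sub _ _
            _ ≤ 2 * C := by linarith [hf (s ^ n * x), hf x]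
        · gcongr
          rw [div_le_iff₀ hn0]
          rw [div_lt_iff₀ hε] at hn
          linarith
      · have : L (fun x => f (s * x)) = fun x => L f (s * x) := by
          funext x
          rw [hL, hL]
          simp only [mul_left_comm]
        rw [this]
        exact hinv s hs _ C (hLbd f C hf)

open Filter in
/-- Abelian groups are amenable: there is an invariant mean, here extended by linearity to all
functions. -/
theorem exists_invariant_mean (G : Type*) [CommGroup G] :
    ∃ m : (G → ℝ) →ₗ[ℝ] ℝ, (∀ f C, (∀ x, |f x| ≤ C) → (∀ x, 0 ≤ f x) → 0 ≤ m f) ∧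
      m (fun _ => 1) = 1 ∧
      ∀ s f C, (∀ x, |f x| ≤ C) → m (fun x => f (s * x)) = m f := by
  classical
  choose A hpos hone hinv using fun p : Finset G × ℕ =>
    exists_almost_invariant_mean p.1 (ε := ((p.2 : ℝ) + 1)⁻¹) (by positivity)
  let U : Ultrafilter (Finset G × ℕ) := Ultrafilter.of atTop
  have hU : (U : Filter (Finset G × ℕ)) ≤ atTop := Ultrafilter.of_le atTop
  let B : Submodule ℝ (G → ℝ) :=
    { carrier := {f | ∃ C, ∀ x, |f x| ≤ C}
      add_mem' := fun {f g} ⟨C, hC⟩ ⟨D, hD⟩ =>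
        ⟨C + D, fun x => (abs_add_le _ _).trans (add_le_add (hC x) (hD x))⟩
      zero_mem' := ⟨0, fun x => by simp⟩
      smul_mem' := fun c f ⟨C, hC⟩ => ⟨|c| * C, fun x => by
        simpa [abs_mul] using mul_le_mul_of_nonneg_left (hC x) (abs_nonneg c)⟩ }
  have hconst : ∀ p (C : ℝ), A p (fun _ => C) = C := by
    intro p C
    have := (A p).map_smul C (fun _ => 1)
    rw [hone] at this
    simpa [Pi.smul_def] using this
  have hbd : ∀ p (f : G → ℝ) (C : ℝ), (∀ x, |f x| ≤ C) → A p f ∈ Set.Icc (-C) C := by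
    intro p f C hf
    have h1 := hpos p ((fun _ => C) - f) fun x => by simpa using (abs_le.1 (hf x)).2
    have h2 := hpos p ((fun _ => C) + f) fun x => by
      have := (abs_le.1 (hf x)).1
      simp only [Pi.add_apply]
      linarith
    rw [map_sub, hconst] at h1
    rw [map_add, hconst] at h2
    exact ⟨by linarith, by linarith⟩
  have hlim : ∀ f : B, ∃ y, Tendsto (fun p => A p f) U (𝓝 y) := by
    rintro ⟨f, C, hC⟩
    obtain ⟨y, -, hy⟩ := isCompact_Icc.ultrafilter_le_nhds (U.map fun p => A p f)
      (tendsto_principal.2 (Eventually.of_forall fun p => hbd p f C hC))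
    exact ⟨y, hy⟩
  choose l hl using hlim
  let m₀ : B →ₗ[ℝ] ℝ :=
    { toFun := l
      map_add' := fun f g => tendsto_nhds_unique (hl (f + g)) (by
        simpa using (hl f).add (hl g))
      map_smul' := fun c f => tendsto_nhds_unique (hl (c • f)) (by
        simpa using (hl f).const_mul c) }
  obtain ⟨m, hm⟩ := m₀.exists_extend
  have hm' : ∀ f (hf : f ∈ B), Tendsto (fun p => A p f) U (𝓝 (m f)) := by
    intro f hf
    have := LinearMap.congr_fun hm ⟨f, hf⟩
    simp only [LinearMap.comp_apply, Submodule.subtype_apply] at this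
    rw [this]
    exact hl ⟨f, hf⟩
  refine ⟨m, fun f C hf h0 => ge_of_tendsto (hm' f ⟨C, hf⟩) (Eventually.of_forall fun p =>
    hpos p f h0), ?_, fun s f C hf => ?_⟩
  · refine tendsto_nhds_unique (hm' _ ⟨1, by simp⟩) ?_
    simp only [hone]
    exact tendsto_const_nhds
  · have h0 : Tendsto (fun p : Finset G × ℕ => ((p.2 : ℝ) + 1)⁻¹ * C) U (𝓝 0) := by
      have h1 : Tendsto (fun p : Finset G × ℕ => p.2) U atTop := by
        refine Tendsto.mono_left ?_ hU
        rw [← prod_atTop_atTop_eq]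
        exact tendsto_snd
      have h2 := (tendsto_one_div_add_atTop_nhds_zero_nat (𝕜 := ℝ)).comp h1
      simpa [Function.comp_def] using h2.mul_const C
    have h3 := (hm' (fun x => f (s * x)) ⟨C, fun x => hf _⟩).sub (hm' f ⟨C, hf⟩)
    have h4 : Tendsto (fun p => A p (fun x => f (s * x)) - A p f) U (𝓝 0) := by
      refine squeeze_zero_norm' ?_ h0
      filter_upwards [hU (Ici_mem_atTop (({s} : Finset G), 0))] with p hp
      exact hinv p s (hp.1 (Finset.mem_singleton_self s)) f C hf
    exact sub_eq_zero.1 (tendsto_nhds_unique h3 h4)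

theorem posSemidef_real_iff {S : Type*} {k : Matrix S S ℝ} :
    k.PosSemidef ↔ (∀ s t, k s t = k t s) ∧
      ∀ (F : Finset S) (c : S → ℝ), 0 ≤ ∑ s ∈ F, ∑ t ∈ F, c s * c t * k s t := by
  classical
  constructor
  · rintro ⟨h1, h2⟩
    refine ⟨fun s t => by simpa using (h1.apply s t).symm, fun F c => ?_⟩
    have := h2 (∑ s ∈ F, Finsupp.single s (c s))
    rw [Finsupp.sum_of_support_subset (s := F)] at this
    · refine this.trans_eq (Finset.sum_congr rfl fun s hs => ?_)
      rw [Finsupp.sum_of_support_subset (s := F)]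
      · refine Finset.sum_congr rfl fun t ht => ?_
        simp [Finsupp.finsetSum_apply, Finsupp.single_apply, hs, ht]
        ring
      · intro t
        contrapose!
        intro ht
        simp +contextual [Finsupp.finsetSum_apply, Finsupp.single_apply, ht]
      · simp
    · intro t
      contrapose!
      intro ht
      simp +contextual [Finsupp.finsetSum_apply, Finsupp.single_apply, ht]
    · simp
  · rintro ⟨h1, h2⟩
    refine ⟨Matrix.IsHermitian.ext fun s t => by simpa using h1 t s, fun x => ?_⟩
    refine (h2 x.support x).trans_eq (Finset.sum_congr rfl fun s _ =>
      Finset.sum_congr rfl fun t _ => ?_)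
    simp
    ring

theorem posSemidef_of_tendsto {S : Type*} {k : ℕ → Matrix S S ℝ} {l : Matrix S S ℝ}
    (hk : ∀ n, (k n).PosSemidef)
    (hl : ∀ s t, Filter.Tendsto (fun n => k n s t) Filter.atTop (𝓝 (l s t))) : l.PosSemidef := by
  refine posSemidef_real_iff.2 ⟨fun s t => ?_, fun F c => ?_⟩
  · refine tendsto_nhds_unique (hl s t) ?_
    simpa only [(posSemidef_real_iff.1 (hk _)).1 s t] using hl t s
  · refine ge_of_tendsto' (x := Filter.atTop)
      (f := fun n => ∑ s ∈ F, ∑ t ∈ F, c s * c t * k n s t) ?_ fun n =>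
      (posSemidef_real_iff.1 (hk n)).2 F c
    exact tendsto_finsetSum _ fun s _ => tendsto_finsetSum _ fun t _ => (hl s t).const_mul _

theorem integral_indicator_exp_mul (x y : ℝ) :
    Integrable (fun t => (Set.Ioi x).indicator (fun t => Real.exp (x - t)) t *
      (Set.Ioi y).indicator (fun t => Real.exp (y - t)) t) ∧
    ∫ t, (Set.Ioi x).indicator (fun t => Real.exp (x - t)) t *
      (Set.Ioi y).indicator (fun t => Real.exp (y - t)) t = Real.exp (-|x - y|) / 2 := by
  have h : (fun t => (Set.Ioi x).indicator (fun t => Real.exp (x - t)) t *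
      (Set.Ioi y).indicator (fun t => Real.exp (y - t)) t) =
      (Set.Ioi (x ⊔ y)).indicator fun t => Real.exp (x + y) * Real.exp (-2 * t) := by
    funext t
    rw [← Set.inter_indicator_mul, Set.Ioi_inter_Ioi]
    refine congrFun (congrArg _ (funext fun u => ?_)) t
    rw [← Real.exp_add, ← Real.exp_add]
    ring_nf
  rw [h, integrable_indicator_iff measurableSet_Ioi, integral_indicator measurableSet_Ioi,
    integral_const_mul, integral_exp_mul_Ioi (by norm_num)]
  refine ⟨((integrableOn_exp_mul_Ioi (by norm_num) _).const_mul _), ?_⟩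
  have : -|x - y| = x + y + -2 * max x y := by
    rcases le_total x y with hxy | hxy
    · rw [max_eq_right hxy, abs_of_nonpos (by linarith)]; ring
    · rw [max_eq_left hxy, abs_of_nonneg (by linarith)]; ring
  rw [this, Real.exp_add (x + y)]
  ring

theorem posSemidef_exp_neg_abs_sub : (Matrix.of fun x y : ℝ => Real.exp (-|x - y|)).PosSemidef := by
  refine posSemidef_real_iff.2 ⟨fun s t => by simp [abs_sub_comm], fun F c => ?_⟩
  let f : ℝ → ℝ → ℝ := fun x => (Set.Ioi x).indicator (fun t => Real.exp (x - t))
  have h : ∑ s ∈ F, ∑ t ∈ F, c s * c t * Real.exp (-|s - t|) =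
      2 * ∫ u, (∑ s ∈ F, c s * f s u) ^ 2 := by
    have : ∀ u, (∑ s ∈ F, c s * f s u) ^ 2 =
        ∑ s ∈ F, ∑ t ∈ F, c s * c t * (f s u * f t u) := by
      intro u
      rw [sq, Finset.sum_mul_sum]
      refine Finset.sum_congr rfl fun s _ => Finset.sum_congr rfl fun t _ => by ring
    simp_rw [this]
    rw [integral_finsetSum _ fun s _ => integrable_finsetSum _ fun t _ =>
      (integral_indicator_exp_mul s t).1.const_mul _, Finset.mul_sum]
    refine Finset.sum_congr rfl fun s _ => ?_
    rw [integral_finsetSum _ fun t _ => (integral_indicator_exp_mul s t).1.const_mul _,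
      Finset.mul_sum]
    refine Finset.sum_congr rfl fun t _ => ?_
    rw [integral_const_mul, (integral_indicator_exp_mul s t).2]
    ring
  refine le_of_le_of_eq ?_ h.symm
  exact mul_nonneg zero_le_two (integral_nonneg fun u => sq_nonneg _)

/-- Finite `ℓ₁`-distances are of negative type. -/
theorem posSemidef_exp_neg_sum_abs_sub {S ι : Type*} (F : Finset ι) (a : ι → S → ℝ) :
    (Matrix.of fun x y : S => Real.exp (-∑ i ∈ F, |a i x - a i y|)).PosSemidef := by
  classical
  induction F using Finset.induction_on with
  | empty =>
    refine posSemidef_real_iff.2 ⟨fun s t => by simp, fun F c => ?_⟩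
    simp only [Finset.sum_empty, neg_zero, Real.exp_zero, Matrix.of_apply, mul_one]
    rw [← Finset.sum_mul_sum]
    exact mul_self_nonneg _
  | insert i F hi ih =>
    convert! (posSemidef_exp_neg_abs_sub.submatrix (a i)).hadamard ih using 1
    ext x y
    simp [Finset.sum_insert hi, Real.exp_add, add_comm]

section ContinuousFunctions

variable {X : Type*} [TopologicalSpace X] [CompactSpace X]

theorem exists_partitionOfUnity_approx {K : Set C(X, ℂ)} (hK : IsCompact K) {ε : ℝ} (hε : 0 < ε) :
    ∃ (m : ℕ) (φ : Fin m → C(X, ℂ)) (c : Fin m → C(X, ℂ) → ℂ), ∑ i, φ i = 1 ∧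
      (∀ x, ∑ i, ‖φ i x‖ ≤ 1) ∧ ∀ g ∈ K, ∀ i x, φ i x ≠ 0 → ‖g x - c i g‖ ≤ ε := by
  obtain ⟨t, htK, htf, ht⟩ := hK.finite_cover_balls (e := ε / 4) (by positivity)
  let D : X → X → ℝ := fun x y => ∑ h ∈ htf.toFinset, ‖h x - h y‖
  have hDc : ∀ y, Continuous fun x => D x y := fun y => by fun_prop
  have hD : ∀ x y, D x y < ε / 2 → ∀ g ∈ K, ‖g x - g y‖ ≤ ε := by
    intro x y hxy g hg
    obtain ⟨h, hht, hgh⟩ := Set.mem_iUnion₂.1 (ht hg)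
    rw [Metric.mem_ball] at hgh
    have h1 : dist (g x) (h x) ≤ ε / 4 := (ContinuousMap.dist_apply_le_dist x).trans hgh.le
    have h2 : dist (g y) (h y) ≤ ε / 4 := (ContinuousMap.dist_apply_le_dist y).trans hgh.le
    have h3 : dist (h x) (h y) ≤ D x y := by
      rw [dist_eq_norm]
      exact Finset.single_le_sum (f := fun h : C(X, ℂ) => ‖h x - h y‖) (fun _ _ => norm_nonneg _)
        (htf.mem_toFinset.2 hht)
    rw [← dist_eq_norm]
    calc dist (g x) (g y) ≤ dist (g x) (h x) + dist (h x) (h y) + dist (h y) (g y) :=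
          dist_triangle4 _ _ _ _
      _ ≤ ε / 4 + ε / 2 + ε / 4 := by
          rw [dist_comm (h y)]
          gcongr
          exact h3.trans hxy.le
      _ = ε := by ring
  obtain ⟨s, hs⟩ := isCompact_univ.elim_finite_subcover (fun y => {x | D x y < ε / 2})
    (fun y => isOpen_lt (hDc y) continuous_const) fun x _ => Set.mem_iUnion.2 ⟨x, by
      simpa [D] using hε⟩
  let y : Fin s.card → X := fun i => s.equivFin.symm i
  let b : Fin s.card → X → ℝ := fun i x => max 0 (ε / 2 - D x (y i))
  have hb0 : ∀ i x, 0 ≤ b i x := fun i x => le_max_left _ _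
  have hbc : ∀ i, Continuous (b i) := fun i =>
    continuous_const.max (continuous_const.sub (hDc _))
  have hbpos : ∀ x, 0 < ∑ i, b i x := by
    intro x
    obtain ⟨z, hz, hxz⟩ := Set.mem_iUnion₂.1 (hs (Set.mem_univ x))
    refine Finset.sum_pos' (fun i _ => hb0 i x) ⟨s.equivFin ⟨z, hz⟩, Finset.mem_univ _, ?_⟩
    refine lt_max_of_lt_right ?_
    simpa [y] using hxz
  have hsum : ∀ x, ∑ i, b i x / ∑ j, b j x = 1 := fun x => by
    rw [← Finset.sum_div, div_self (hbpos x).ne']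
  refine ⟨s.card, fun i => ⟨fun x => ((b i x / ∑ j, b j x : ℝ) : ℂ), ?_⟩, fun i g => g (y i),
    ?_, fun x => ?_, fun g hg i x hx => hD x (y i) ?_ g hg⟩
  · exact Complex.continuous_ofReal.comp ((hbc i).div (continuous_finsetSum _ fun j _ => hbc j)
      fun x => (hbpos x).ne')
  · ext x
    rw [ContinuousMap.sum_apply]
    simp only [ContinuousMap.coe_mk, ContinuousMap.one_apply]
    exact_mod_cast congrArg ((↑) : ℝ → ℂ) (hsum x)
  · refine le_of_eq ((Finset.sum_congr rfl fun i _ => ?_).trans (hsum x))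
    rw [ContinuousMap.coe_mk, Complex.norm_real, Real.norm_of_nonneg]
    exact div_nonneg (hb0 i x) (hbpos x).le
  · by_contra hcon
    refine hx ?_
    have : b i x = 0 := max_eq_left (by linarith)
    simp [this]

theorem exists_series_decomposition {K : Set C(X, ℂ)} (hK : IsCompact K) :
    ∃ (ι : ℕ → Type) (_ : ∀ n, Fintype (ι n)) (Ψ : ∀ n, ι n → C(X, ℂ)) (w : ℕ → ℝ), Summable w ∧
      (∀ n, 0 ≤ w n) ∧ (∀ n x, ∑ i, ‖Ψ n i x‖ ≤ w n) ∧
      ∀ g ∈ K, ∃ d : ∀ n, ι n → ℂ, (∀ n i, ‖d n i‖ ≤ 1) ∧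
        Filter.Tendsto (fun N => ∑ n ∈ Finset.range N, ∑ i, d n i • Ψ n i) Filter.atTop (𝓝 g) := by
  classical
  obtain ⟨M, hM0, hM⟩ := hK.isBounded.exists_pos_norm_le
  let ω : ℕ → ℝ := fun n => n.casesOn M fun k => (1 / 2) ^ k
  have hω0 : ∀ n, 0 < ω n := by
    rintro (_ | n)
    · exact hM0
    · exact pow_pos (by norm_num) n
  have hωs : Summable fun n => ω (n + 1) := summable_geometric_two
  have hωs' : Summable ω := (summable_nat_add_iff 1).1 hωs
  have hpart : ∀ n, ∃ (m : ℕ) (φ : Fin m → C(X, ℂ)) (c : Fin m → C(X, ℂ) → ℂ), ∑ i, φ i = 1 ∧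
      (∀ x, ∑ i, ‖φ i x‖ ≤ 1) ∧ (∀ g ∈ K, ∀ i x, φ i x ≠ 0 → ‖g x - c i g‖ ≤ ω n) ∧
      (n = 0 → ∀ i g, c i g = 0) := by
    rintro (_ | n)
    · refine ⟨1, fun _ => 1, fun _ _ => 0, by simp, by simp, fun g hg i x _ => ?_, by simp⟩
      rw [sub_zero]
      exact (g.norm_coe_le_norm x).trans (hM g hg)
    · obtain ⟨m, φ, c, h1, h2, h3⟩ := exists_partitionOfUnity_approx hK (hω0 (n + 1))
      exact ⟨m, φ, c, h1, h2, h3, by simp⟩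
  choose m φ c h1 h2 h3 h4 using hpart
  have hw : ∀ n, 0 < ω n + ω (n + 1) := fun n => add_pos (hω0 n) (hω0 (n + 1))
  refine ⟨fun n => Fin (m n) × Fin (m (n + 1)), inferInstance,
    fun n p => ((ω n + ω (n + 1) : ℝ) : ℂ) • (φ n p.1 * φ (n + 1) p.2),
    fun n => ω n + ω (n + 1), hωs'.add hωs, fun n => (hw n).le, fun n x => ?_, fun g hg => ?_⟩
  · have : ∀ p : Fin (m n) × Fin (m (n + 1)),
        ‖(((ω n + ω (n + 1) : ℝ) : ℂ) • (φ n p.1 * φ (n + 1) p.2)) x‖ =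
          (ω n + ω (n + 1)) * (‖φ n p.1 x‖ * ‖φ (n + 1) p.2 x‖) := fun p => by
      rw [ContinuousMap.smul_apply, ContinuousMap.mul_apply, norm_smul, norm_mul,
        Complex.norm_real, Real.norm_of_nonneg (hw n).le]
    simp_rw [this]
    rw [← Finset.mul_sum, Fintype.sum_prod_type]
    dsimp only
    rw [← Finset.sum_mul_sum]
    refine mul_le_of_le_one_right (hw n).le (mul_le_one₀ (h2 n x) ?_ (h2 (n + 1) x))
    exact Finset.sum_nonneg fun i _ => norm_nonneg _
  · let γ : ℕ → C(X, ℂ) := fun n => ∑ i, c n i g • φ n i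
    have hγ : ∀ n, ‖γ n - g‖ ≤ ω n := by
      intro n
      refine (ContinuousMap.norm_le _ (hω0 n).le).2 fun x => ?_
      have hg1 : g x = ∑ i, g x * φ n i x := by
        have := congrArg (fun f : C(X, ℂ) => f x) (h1 n)
        simp only [ContinuousMap.sum_apply, ContinuousMap.one_apply] at this
        rw [← Finset.mul_sum, this, mul_one]
      rw [ContinuousMap.sub_apply, ContinuousMap.sum_apply, hg1, ← Finset.sum_sub_distrib]
      calc ‖∑ i, ((c n i g • φ n i) x - g x * φ n i x)‖
          ≤ ∑ i, ω n * ‖φ n i x‖ := by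
            refine norm_sum_le_of_le _ fun i _ => ?_
            rw [ContinuousMap.smul_apply, smul_eq_mul, ← sub_mul, norm_mul, norm_sub_rev]
            by_cases hx : φ n i x = 0
            · simp [hx]
            · gcongr
              exact h3 n g hg i x hx
        _ ≤ ω n := by
            rw [← Finset.mul_sum]
            exact mul_le_of_le_one_right (hω0 n).le (h2 n x)
    have hγ0 : γ 0 = 0 := Finset.sum_eq_zero fun i _ => by rw [h4 0 rfl, zero_smul]
    refine ⟨fun n p => if φ n p.1 * φ (n + 1) p.2 = 0 then 0 else
      (c (n + 1) p.2 g - c n p.1 g) / ((ω n + ω (n + 1) : ℝ) : ℂ), fun n p => ?_, ?_⟩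
    · dsimp only
      split_ifs with hp
      · simp
      · obtain ⟨x, hx⟩ : ∃ x, (φ n p.1 * φ (n + 1) p.2) x ≠ 0 := by
          by_contra! hcon
          exact hp (ContinuousMap.ext hcon)
        rw [ContinuousMap.mul_apply] at hx
        rw [norm_div, Complex.norm_real, Real.norm_of_nonneg (hw n).le, div_le_one (hw n)]
        calc ‖c (n + 1) p.2 g - c n p.1 g‖ = ‖(g x - c n p.1 g) - (g x - c (n + 1) p.2 g)‖ := by
              congr 1; ring
          _ ≤ _ := (norm_sub_le _ _).trans (add_le_add (h3 n g hg _ x (left_ne_zero_of_mul hx))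
              (h3 (n + 1) g hg _ x (right_ne_zero_of_mul hx)))
    · have hterm : ∀ n, ∑ p : Fin (m n) × Fin (m (n + 1)),
          (if φ n p.1 * φ (n + 1) p.2 = 0 then 0 else
            (c (n + 1) p.2 g - c n p.1 g) / ((ω n + ω (n + 1) : ℝ) : ℂ)) •
            ((ω n + ω (n + 1) : ℝ) : ℂ) • (φ n p.1 * φ (n + 1) p.2) = γ (n + 1) - γ n := by
        intro n
        have hne : ((ω n + ω (n + 1) : ℝ) : ℂ) ≠ 0 := by exact_mod_cast (hw n).ne'
        have e : ∀ p : Fin (m n) × Fin (m (n + 1)),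
          (if φ n p.1 * φ (n + 1) p.2 = 0 then 0 else
            (c (n + 1) p.2 g - c n p.1 g) / ((ω n + ω (n + 1) : ℝ) : ℂ)) •
            ((ω n + ω (n + 1) : ℝ) : ℂ) • (φ n p.1 * φ (n + 1) p.2) =
            φ n p.1 * (c (n + 1) p.2 g • φ (n + 1) p.2) -
              (c n p.1 g • φ n p.1) * φ (n + 1) p.2 := by
          intro p
          rw [mul_smul_comm, smul_mul_assoc, ← sub_smul]
          split_ifs with hp
          · simp [hp]
          · rw [smul_smul, div_mul_cancel₀ _ hne]
        simp_rw [e]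
        rw [Finset.sum_sub_distrib, Fintype.sum_prod_type, Fintype.sum_prod_type]
        dsimp only
        rw [← Finset.sum_mul_sum, ← Finset.sum_mul_sum, h1, h1, one_mul, mul_one]
      simp_rw [hterm, Finset.sum_range_sub, hγ0, sub_zero]
      exact tendsto_iff_norm_sub_tendsto_zero.2
        (squeeze_zero (fun _ => norm_nonneg _) hγ hωs'.tendsto_atTop_zero)

end ContinuousFunctions

section Dual

variable {X : Type*} [TopologicalSpace X] [CompactSpace X]

/-- On the dual of `C(X)`, the seminorm of uniform convergence on a compact set `K` is dominated by
an `ℓ₁`-type seminorm of negative type, which is itself continuous for uniform convergence on the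
compact sets. -/
theorem exists_negativeType_dominating {K : Set C(X, ℂ)} (hK : IsCompact K) :
    ∃ (N : (C(X, ℂ) →L[ℂ] ℂ) → ℝ) (K' : Set C(X, ℂ)), IsCompact K' ∧
      (∀ ν, ∀ g ∈ K, ‖ν g‖ ≤ N ν) ∧
      (∀ ν ε, (∀ g ∈ K', ‖ν g‖ ≤ ε) → N ν ≤ 2 * ε) ∧ (∀ ν, 0 ≤ N ν) ∧ N 0 = 0 ∧
      (Matrix.of fun ν ν' => Real.exp (-N (ν - ν'))).PosSemidef := by
  classical
  obtain ⟨ι, _, Ψ, w, hws, hw0, hΨ, hdec⟩ := exists_series_decomposition hK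
  have hcomb : ∀ (n : ℕ) (s : ι n → ℂ), (∀ i, ‖s i‖ ≤ 1) → ‖∑ i, s i • Ψ n i‖ ≤ w n := by
    intro n s hs
    refine (ContinuousMap.norm_le _ (hw0 n)).2 fun x => ?_
    rw [ContinuousMap.sum_apply]
    refine (norm_sum_le_of_le _ fun i _ => ?_).trans (hΨ n x)
    rw [ContinuousMap.smul_apply, norm_smul]
    exact mul_le_of_le_one_left (norm_nonneg _) (hs i)
  let Q : Set (∀ n, ι n → ℂ) := Set.univ.pi fun n => Set.univ.pi fun i => Metric.closedBall 0 1
  have hQ : IsCompact Q := isCompact_univ_pi fun n => isCompact_univ_pi fun i =>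
    isCompact_closedBall 0 1
  have hQm : ∀ s, s ∈ Q ↔ ∀ n i, ‖s n i‖ ≤ 1 := fun s => by
    simp [Q, Set.mem_pi]
  let Φ : (∀ n, ι n → ℂ) → C(X, ℂ) := fun s => ∑' n, ∑ i, s n i • Ψ n i
  have hΦc : ContinuousOn Φ Q := by
    refine continuousOn_tsum (fun n => Continuous.continuousOn ?_) hws fun n s hs =>
      hcomb n (s n) ((hQm s).1 hs n)
    fun_prop
  have hΦs : ∀ s ∈ Q, HasSum (fun n => ∑ i, s n i • Ψ n i) (Φ s) := fun s hs =>
    (Summable.of_norm_bounded hws fun n => hcomb n (s n) ((hQm s).1 hs n)).hasSum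
  have hsgn : ∀ z : ℂ, ∃ u : ℂ, ‖u‖ ≤ 1 ∧ u * z = (‖z‖ : ℂ) := by
    intro z
    by_cases hz : z = 0
    · exact ⟨0, by simp, by simp [hz]⟩
    · have hz' : (‖z‖ : ℂ) ≠ 0 := by exact_mod_cast norm_ne_zero_iff.2 hz
      refine ⟨(‖z‖ : ℂ) / z, ?_, div_mul_cancel₀ _ hz⟩
      rw [norm_div, Complex.norm_real, norm_norm, div_self (norm_ne_zero_iff.2 hz)]
  choose sgn hsgn1 hsgn2 using hsgn
  have hsig : ∀ ν : C(X, ℂ) →L[ℂ] ℂ, ∃ g ∈ Φ '' Q,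
      HasSum (fun n => ((∑ i, ‖ν (Ψ n i)‖ : ℝ) : ℂ)) (ν g) := by
    intro ν
    have hs : (fun n i => sgn (ν (Ψ n i)) : ∀ n, ι n → ℂ) ∈ Q := (hQm _).2 fun n i => hsgn1 _
    refine ⟨_, ⟨_, hs, rfl⟩, ?_⟩
    have := (hΦs _ hs).mapL ν
    simpa [map_sum, hsgn2] using this
  have hnsum : ∀ ν : C(X, ℂ) →L[ℂ] ℂ, Summable fun n => ∑ i, ‖ν (Ψ n i)‖ := by
    intro ν
    obtain ⟨g, -, hg⟩ := hsig ν
    exact Complex.summable_ofReal.1 hg.summable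
  let a : (C(X, ℂ) →L[ℂ] ℂ) → ℕ → ℝ := fun ν n => ∑ i, (|(ν (Ψ n i)).re| + |(ν (Ψ n i)).im|)
  have ha0 : ∀ ν n, 0 ≤ a ν n := fun ν n => Finset.sum_nonneg fun i _ => by positivity
  have ha1 : ∀ ν n, ∑ i, ‖ν (Ψ n i)‖ ≤ a ν n := fun ν n =>
    Finset.sum_le_sum fun i _ => Complex.norm_le_abs_re_add_abs_im _
  have ha2 : ∀ ν n, a ν n ≤ 2 * ∑ i, ‖ν (Ψ n i)‖ := by
    intro ν n
    rw [Finset.mul_sum]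
    refine Finset.sum_le_sum fun i _ => ?_
    linarith [Complex.abs_re_le_norm (ν (Ψ n i)), Complex.abs_im_le_norm (ν (Ψ n i))]
  have has : ∀ ν, Summable (a ν) := fun ν =>
    Summable.of_nonneg_of_le (ha0 ν) (ha2 ν) ((hnsum ν).mul_left 2)
  refine ⟨fun ν => ∑' n, a ν n, Φ '' Q, hQ.image_of_continuousOn hΦc, fun ν g hg => ?_,
    fun ν ε hν => ?_, fun ν => tsum_nonneg (ha0 ν), by simp [a], ?_⟩
  · obtain ⟨d, hd1, hd2⟩ := hdec g hg
    refine le_of_tendsto ((ν.continuous.tendsto g).comp hd2).norm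
      (Filter.Eventually.of_forall fun M => ?_)
    refine le_trans ?_ ((has ν).sum_le_tsum (Finset.range M) fun n _ => ha0 ν n)
    simp only [Function.comp_apply, map_sum, map_smul]
    refine norm_sum_le_of_le _ fun n _ => (norm_sum_le _ _).trans (le_trans ?_ (ha1 ν n))
    refine Finset.sum_le_sum fun i _ => ?_
    rw [norm_smul]
    exact mul_le_of_le_one_left (norm_nonneg _) (hd1 n i)
  · obtain ⟨g, hg, hsum⟩ := hsig ν
    have h1 : ((∑' n, ∑ i, ‖ν (Ψ n i)‖ : ℝ) : ℂ) = ν g := by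
      rw [Complex.ofReal_tsum]
      exact hsum.tsum_eq
    have h2 : ∑' n, ∑ i, ‖ν (Ψ n i)‖ ≤ ε := by
      refine le_trans ?_ (hν g hg)
      rw [← h1, Complex.norm_real]
      exact le_abs_self _
    calc ∑' n, a ν n ≤ ∑' n, 2 * ∑ i, ‖ν (Ψ n i)‖ :=
          (has ν).tsum_le_tsum (ha2 ν) ((hnsum ν).mul_left 2)
      _ ≤ 2 * ε := by rw [tsum_mul_left]; gcongr
  · refine posSemidef_of_tendsto (k := fun M => Matrix.of fun ν ν' =>
      Real.exp (-∑ n ∈ Finset.range M, a (ν - ν') n)) (fun M => ?_) fun ν ν' => ?_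
    · have hre := posSemidef_exp_neg_sum_abs_sub ((Finset.range M).sigma fun n => Finset.univ)
        fun (p : Σ n, ι n) (ν : C(X, ℂ) →L[ℂ] ℂ) => (ν (Ψ p.1 p.2)).re
      have him := posSemidef_exp_neg_sum_abs_sub ((Finset.range M).sigma fun n => Finset.univ)
        fun (p : Σ n, ι n) (ν : C(X, ℂ) →L[ℂ] ℂ) => (ν (Ψ p.1 p.2)).im
      convert! hre.hadamard him using 1
      ext ν ν'
      simp only [Matrix.of_apply, Matrix.hadamard_apply, ← Real.exp_add, Finset.sum_sigma, a,
        sub_apply, Complex.sub_re, Complex.sub_im, Finset.sum_add_distrib]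
      congr 1
      ring
    · exact (Real.continuous_exp.tendsto _).comp (has (ν - ν')).hasSum.tendsto_sum_nat.neg

end Dual

open ComplexConjugate in
/-- The Kolmogorov decomposition of a real positive semidefinite kernel. -/
theorem exists_hilbertSpace_of_posSemidef.{u} {S : Type u} {k : Matrix S S ℝ}
    (hk : k.PosSemidef) :
    ∃ (H : Type u) (_ : NormedAddCommGroup H) (_ : InnerProductSpace ℂ H) (_ : CompleteSpace H)
      (e : (S →₀ ℂ) →ₗ[ℂ] H), DenseRange e ∧
        ∀ x y, inner ℂ (e x) (e y) = x.sum fun s z => y.sum fun t w => conj z * w * (k s t : ℂ) := by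
  have hk' := posSemidef_real_iff.1 hk
  let core : PreInnerProductSpace.Core ℂ (S →₀ ℂ) :=
    { inner := fun x y => x.sum fun s z => y.sum fun t w => conj z * w * (k s t : ℂ)
      conj_inner_symm := fun x y => by
        rw [Finsupp.sum_comm]
        simp only [map_finsuppSum, map_mul, Complex.conj_conj, Complex.conj_ofReal]
        refine Finset.sum_congr rfl fun s _ => Finset.sum_congr rfl fun t _ => ?_
        dsimp only
        rw [hk'.1 t s]
        ring
      add_left := fun x y z => by
        rw [Finsupp.sum_add_index'] <;> simp [← Finsupp.sum_add, add_mul]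
      smul_left := fun x y r => by
        rw [Finsupp.sum_smul_index] <;> simp [Finsupp.mul_sum, ← mul_assoc]
      re_inner_nonneg := fun x => by
        have h1 := hk'.2 x.support fun s => (x s).re
        have h2 := hk'.2 x.support fun s => (x s).im
        refine (add_nonneg h1 h2).trans_eq ?_
        simp only [Finsupp.sum, ← Finset.sum_add_distrib, RCLike.re_to_complex, Complex.re_sum]
        refine Finset.sum_congr rfl fun s _ => Finset.sum_congr rfl fun t _ => ?_
        simp
        ring }
  let : SeminormedAddCommGroup (S →₀ ℂ) :=
    InnerProductSpace.Core.toSeminormedAddCommGroup (𝕜 := ℂ)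
  let : InnerProductSpace ℂ (S →₀ ℂ) := .ofCore core
  refine ⟨UniformSpace.Completion (S →₀ ℂ), inferInstance, inferInstance, inferInstance,
    (UniformSpace.Completion.toComplₗᵢ (𝕜 := ℂ) (E := S →₀ ℂ)).toLinearMap,
    UniformSpace.Completion.denseRange_coe, fun x y => ?_⟩
  exact UniformSpace.Completion.inner_coe x y

/-- The orthogonal sum of positive semidefinite kernels is positive semidefinite. -/
theorem posSemidef_blockDiagonal {I S : Type*} [DecidableEq I] {k : I → Matrix S S ℝ}
    (hk : ∀ i, (k i).PosSemidef) :
    (Matrix.of fun p q : I × S => if p.1 = q.1 then k p.1 p.2 q.2 else 0).PosSemidef := by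
  classical
  refine posSemidef_real_iff.2 ⟨fun p q => ?_, fun F c => ?_⟩
  · by_cases h : p.1 = q.1
    · simp [h, (posSemidef_real_iff.1 (hk q.1)).1 p.2 q.2]
    · simp [h, Ne.symm h]
  · let J := F.image Prod.fst
    let R := F.image Prod.snd
    let d : I → S → ℝ := fun i s => if (i, s) ∈ F then c (i, s) else 0
    have hsub : F ⊆ J ×ˢ R := fun p hp => Finset.mem_product.2
      ⟨Finset.mem_image_of_mem _ hp, Finset.mem_image_of_mem _ hp⟩
    have key : ∀ f : I × S → ℝ, ∑ p ∈ F, c p * f p = ∑ i ∈ J, ∑ s ∈ R, d i s * f (i, s) := by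
      intro f
      rw [← Finset.sum_product' (s := J) (t := R) (f := fun i s => d i s * f (i, s)),
        ← Finset.sum_subset hsub]
      · exact Finset.sum_congr rfl fun p hp => by simp [d, hp]
      · intro p _ hp
        simp [d, hp]
    have : ∑ p ∈ F, ∑ q ∈ F, c p * c q * (if p.1 = q.1 then k p.1 p.2 q.2 else 0) =
        ∑ i ∈ J, ∑ s ∈ R, ∑ t ∈ R, d i s * d i t * k i s t := by
      simp_rw [mul_assoc, ← Finset.mul_sum]
      rw [key]
      refine Finset.sum_congr rfl fun i hi => Finset.sum_congr rfl fun s _ => ?_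
      congr 1
      rw [key, Finset.sum_eq_single_of_mem i hi]
      · simp
      · intro j _ hj
        simp [Ne.symm hj]
    simp only [Matrix.of_apply]
    rw [this]
    exact Finset.sum_nonneg fun i _ => (posSemidef_real_iff.1 (hk i)).2 R (d i)

/-- A Hausdorff abelian group whose topology is generated by continuous positive definite functions
is unitarily representable. -/
theorem isUnitarilyRepresentable_of_posSemidef.{u} {G : Type u} [CommGroup G] [TopologicalSpace G]
    [IsTopologicalGroup G] [T0Space G]
    (h : ∀ U ∈ 𝓝 (1 : G), ∃ ψ : G → ℝ, ψ 1 = 1 ∧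
      (Matrix.of fun a b : G => ψ (a * b⁻¹)).PosSemidef ∧ ContinuousAt ψ 1 ∧
      ∃ δ > 0, ∀ g, 1 - δ < ψ g → g ∈ U) :
    IsUnitarilyRepresentable G := by
  classical
  choose! ψ hψ1 hψpos hψc δ hδ hψU using h
  let I : Type u := {U : Set G // U ∈ 𝓝 (1 : G)}
  let k : Matrix (I × G) (I × G) ℝ :=
    Matrix.of fun p q => if p.1 = q.1 then ψ p.1.1 (p.2 * q.2⁻¹) else 0
  have hk : k.PosSemidef :=
    posSemidef_blockDiagonal (k := fun i : I => Matrix.of fun a b : G => ψ i.1 (a * b⁻¹))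
      fun i => hψpos i.1 i.2
  obtain ⟨H, _, _, _, e, hd, he⟩ := exists_hilbertSpace_of_posSemidef hk
  let σ : G → (I × G) ≃ (I × G) := fun g => Equiv.prodCongr (Equiv.refl I) (Equiv.mulLeft g)
  have hkσ : ∀ g p q, k (σ g p) (σ g q) = k p q := by
    intro g p q
    simp only [k, σ, Matrix.of_apply, Equiv.prodCongr_apply, Prod.map_fst, Prod.map_snd,
      Equiv.refl_apply, Equiv.coe_mulLeft]
    congr 2
    rw [mul_inv, mul_mul_mul_comm, mul_inv_cancel, one_mul]
  let f : G → ((I × G) →₀ ℂ) ≃ₗ[ℂ] ((I × G) →₀ ℂ) := fun g => Finsupp.domLCongr (σ g)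
  have hf : ∀ g x, f g x = x.mapDomain (σ g) := fun g x =>
    Finsupp.equivMapDomain_eq_mapDomain _ _
  have hnorm : ∀ g x, ‖e (f g x)‖ = ‖e x‖ := by
    intro g x
    have : inner ℂ (e (f g x)) (e (f g x)) = inner ℂ (e x) (e x) := by
      rw [he, he, hf, Finsupp.sum_mapDomain_index_inj (σ g).injective]
      refine Finsupp.sum_congr fun s _ => ?_
      rw [Finsupp.sum_mapDomain_index_inj (σ g).injective]
      simp only [hkσ]
    rw [inner_self_eq_norm_sq_to_K, inner_self_eq_norm_sq_to_K] at this
    have h2 : ‖e (f g x)‖ ^ 2 = ‖e x‖ ^ 2 := by exact_mod_cast this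
    exact (sq_eq_sq₀ (norm_nonneg _) (norm_nonneg _)).1 h2
  let V₀ : G → (H ≃ₗᵢ[ℂ] H) := fun g => (f g).extendOfIsometry e e hd hd (hnorm g)
  have hV₀ : ∀ g x, V₀ g (e x) = e (x.mapDomain (σ g)) := fun g x => by
    rw [← hf]
    exact LinearEquiv.extendOfIsometry_eq _ _ _ hd hd (hnorm g) x
  let V : G →* (H ≃ₗᵢ[ℂ] H) :=
    { toFun := V₀
      map_one' := by
        refine DFunLike.coe_injective (hd.equalizer (V₀ 1).continuous continuous_id ?_)
        funext x
        have : (σ 1 : I × G → I × G) = id := by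
          funext p
          simp [σ]
        simp [hV₀, this, Finsupp.mapDomain_id]
      map_mul' := fun a b => by
        refine DFunLike.coe_injective
          (hd.equalizer (V₀ (a * b)).continuous (V₀ a * V₀ b).continuous ?_)
        funext x
        have : (σ (a * b) : I × G → I × G) = σ a ∘ σ b := by
          funext p
          exact Prod.ext rfl (mul_assoc a b p.2)
        simp [hV₀, this, Finsupp.mapDomain_comp] }
  let w : I × G → H := fun p => e (Finsupp.single p 1)
  have hw : ∀ p q, inner ℂ (w p) (w q) = (k p q : ℂ) := fun p q => by simp [w, he]
  have hkd : ∀ i a b, k (i, a) (i, b) = ψ i.1 (a * b⁻¹) := fun i a b => by simp [k]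
  have hkdiag : ∀ p, k p p = 1 := fun p => by simp [k, hψ1 p.1.1 p.1.2]
  have hdist : ∀ i a b, ‖w (i, a) - w (i, b)‖ ^ 2 = 2 - 2 * ψ i.1 (a * b⁻¹) := by
    intro i a b
    rw [@norm_sub_sq ℂ]
    have hn : ∀ p, ‖w p‖ ^ 2 = 1 := fun p => by
      rw [← inner_self_eq_norm_sq (𝕜 := ℂ), hw, hkdiag]
      simp
    rw [hn, hn, hw, hkd]
    simp
    ring
  have hVw : ∀ g i a, V g (w (i, a)) = w (i, g * a) := fun g i a => by
    change V₀ g (e _) = _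
    rw [hV₀, Finsupp.mapDomain_single]
    rfl
  have hwc : ∀ i a, Continuous fun g => w (i, g * a) := by
    intro i a
    refine continuous_iff_continuousAt.2 fun g₀ => tendsto_iff_norm_sub_tendsto_zero.2 ?_
    have h1 : Filter.Tendsto (fun g => g * a * (g₀ * a)⁻¹) (𝓝 g₀) (𝓝 1) := by
      have : Continuous fun g => g * a * (g₀ * a)⁻¹ := by fun_prop
      simpa using this.tendsto g₀
    have h2 := ((hψc i.1 i.2).tendsto.comp h1).const_mul 2
    rw [hψ1 i.1 i.2] at h2
    have h3 := (h2.const_sub 2).sqrt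
    simp only [mul_one, sub_self, Real.sqrt_zero] at h3
    refine h3.congr fun g => ?_
    rw [Function.comp_apply, ← hdist, Real.sqrt_sq (norm_nonneg _)]
  have hVe : ∀ x, Continuous fun g => V g (e x) := by
    intro x
    induction x using Finsupp.induction_linear with
    | zero => simpa using continuous_const
    | add x y hx hy =>
      simp only [map_add]
      exact hx.add hy
    | single p z =>
      have : ∀ g, V g (e (Finsupp.single p z)) = z • w (p.1, g * p.2) := fun g => by
        rw [← hVw, ← map_smul, ← map_smul, Finsupp.smul_single_one]
      simp_rw [this]
      exact (hwc p.1 p.2).const_smul z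
  have hVc : ∀ ξ, Continuous fun g => V g ξ := by
    intro ξ
    refine continuous_of_uniform_approx_of_continuous fun u hu => ?_
    obtain ⟨ε, hε, hεu⟩ := Metric.mem_uniformity_dist.1 hu
    obtain ⟨x, hx⟩ := Metric.denseRange_iff.1 hd ξ ε hε
    exact ⟨_, hVe x, fun g => hεu (by rwa [(V g).dist_map])⟩
  refine ⟨H, inferInstance, inferInstance, inferInstance,
    Unitary.linearIsometryEquiv.symm.toMonoidHom.comp V, ?_⟩
  let _ : TopologicalSpace (unitary (H →L[ℂ] H)) := unitarySOT H
  refine IsInducing.isEmbedding ⟨?_⟩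
  rw [induced_compose]
  have hF : IsInducing fun (g : G) (ξ : H) => V g ξ := by
    refine isInducing_iff_nhds.2 fun g => le_antisymm ?_ ?_
    · exact ((continuous_pi hVc).tendsto g).le_comap
    · intro W hW
      have hU : (fun u => u * g) ⁻¹' W ∈ 𝓝 (1 : G) := by
        refine (continuous_mul_const g).continuousAt.preimage_mem_nhds ?_
        simpa using hW
      let i : I := ⟨_, hU⟩
      refine ⟨(fun φ : H → H => φ (w (i, 1))) ⁻¹'
        Metric.ball (V g (w (i, 1))) (Real.sqrt (2 * δ i.1)), ?_, fun g' hg' => ?_⟩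
      · exact (continuous_apply _).continuousAt.preimage_mem_nhds
          (Metric.ball_mem_nhds _ (Real.sqrt_pos.2 (mul_pos two_pos (hδ i.1 i.2))))
      · simp only [Set.mem_preimage, Metric.mem_ball, hVw, mul_one, dist_eq_norm] at hg'
        have h1 := (Real.lt_sqrt (norm_nonneg _)).1 hg'
        rw [hdist] at h1
        have h2 := hψU i.1 i.2 (g' * g⁻¹) (by linarith)
        simpa [i] using h2
  exact hF.eq_induced

section Averaging

variable {X : Type*} [TopologicalSpace X] [CompactSpace X] [MeasurableSpace X] [BorelSpace X]

/-- An element of `L₁(X, μ)` as a functional on `C(X)`. -/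
noncomputable def L1TauK.toDual (μ : Measure X) (f : L1TauK μ) : C(X, ℂ) →L[ℂ] ℂ :=
  LinearMap.mkContinuous
    { toFun := fun g => ∫ x, (show Lp ℂ 1 μ from f) x * g x ∂μ
      map_add' := fun g₁ g₂ => by
        rw [← integral_add (L1TauK.integrable_mul μ f g₁) (L1TauK.integrable_mul μ f g₂)]
        simp only [ContinuousMap.add_apply, mul_add]
      map_smul' := fun c g => by
        simp only [ContinuousMap.smul_apply, smul_eq_mul, RingHom.id_apply, mul_left_comm _ c]
        exact integral_const_mul _ _ }
    (∫ x, ‖(show Lp ℂ 1 μ from f) x‖ ∂μ) fun g => by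
      rw [← integral_mul_const]
      refine norm_integral_le_of_norm_le ((L1.integrable_coeFn _).norm.mul_const _)
        (Filter.Eventually.of_forall fun x => ?_)
      rw [norm_mul]
      gcongr
      exact g.norm_coe_le_norm x

theorem L1TauK.hasBasis_uniformity (μ : Measure X) :
    (uniformity (L1TauK μ)).HasBasis (fun p : Set C(X, ℂ) × ℝ => IsCompact p.1 ∧ 0 < p.2)
      fun p => {f | ∀ g ∈ p.1, dist (L1TauK.toDual μ f.1 g) (L1TauK.toDual μ f.2 g) < p.2} :=
  (UniformOnFun.hasBasis_uniformity_of_basis C(X, ℂ) ℂ {K : Set C(X, ℂ) | IsCompact K}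
    ⟨∅, isCompact_empty⟩
    (fun K hK L hL => ⟨K ∪ L, hK.union hL, Set.subset_union_left, Set.subset_union_right⟩)
    Metric.uniformity_basis_dist).comap _

open Filter in
/-- Averaging negative type functions over an abelian group. -/
theorem exists_posDef_of_isUniformEmbedding {G : Type*} [CommGroup G] [TopologicalSpace G]
    [IsTopologicalGroup G] (μ : Measure X) {T : G → L1TauK μ}
    (hT : @IsUniformEmbedding G (L1TauK μ) (IsTopologicalGroup.rightUniformSpace G) inferInstance T)
    {U : Set G} (hU : U ∈ 𝓝 (1 : G)) :
    ∃ ψ : G → ℝ, ψ 1 = 1 ∧ (Matrix.of fun a b : G => ψ (a * b⁻¹)).PosSemidef ∧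
      ContinuousAt ψ 1 ∧ ∃ δ > 0, ∀ g, 1 - δ < ψ g → g ∈ U := by
  have hcomap : comap (fun p : G × G => p.2 * p.1⁻¹) (𝓝 1) =
      comap (fun p : G × G => (T p.1, T p.2)) (uniformity (L1TauK μ)) := by
    let _ : UniformSpace G := IsTopologicalGroup.rightUniformSpace G
    exact hT.comap_uniformity.symm
  let η : G → (C(X, ℂ) →L[ℂ] ℂ) := fun g => L1TauK.toDual μ (T g)
  have hout : ∃ K : Set C(X, ℂ), IsCompact K ∧ ∃ ε > 0, ∀ a b : G,
      (∀ g ∈ K, ‖(η a - η b) g‖ < ε) → a * b⁻¹ ∈ U := by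
    have h1 : (fun p : G × G => p.2 * p.1⁻¹) ⁻¹' U ∈
        comap (fun p : G × G => (T p.1, T p.2)) (uniformity (L1TauK μ)) :=
      hcomap ▸ preimage_mem_comap hU
    obtain ⟨⟨K, ε⟩, ⟨hK, hε⟩, hsub⟩ :=
      (((L1TauK.hasBasis_uniformity μ).comap fun p : G × G => (T p.1, T p.2)).mem_iff).1 h1
    refine ⟨K, hK, ε, hε, fun a b hab => hsub (a := (b, a)) fun g hg => ?_⟩
    rw [dist_comm, dist_eq_norm]
    exact hab g hg
  have hin : ∀ K : Set C(X, ℂ), IsCompact K → ∀ ε > 0, ∀ᶠ u in 𝓝 (1 : G), ∀ h : G,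
      ∀ g ∈ K, ‖(η (u * h) - η h) g‖ ≤ ε := by
    intro K hK ε hε
    have h1 := preimage_mem_comap (m := fun p : G × G => (T p.1, T p.2))
      ((L1TauK.hasBasis_uniformity μ).mem_of_mem (i := (K, ε)) ⟨hK, hε⟩)
    rw [← hcomap] at h1
    obtain ⟨W, hW, hsub⟩ := mem_comap.1 h1
    filter_upwards [hW] with u hu h g hg
    have := hsub (a := (h, u * h)) (by simpa using hu) g hg
    rw [dist_comm, dist_eq_norm] at this
    exact this.le
  obtain ⟨K, hK, ε, hε, hKU⟩ := hout
  obtain ⟨N, K', hK', hN1, hN2, hN0, hNz, hNpos⟩ := exists_negativeType_dominating hK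
  obtain ⟨m, hmpos, hm1, hminv⟩ := exists_invariant_mean G
  let k : Matrix G G ℝ := Matrix.of fun a b => Real.exp (-N (η a - η b))
  have hk : k.PosSemidef := hNpos.submatrix η
  have hk' := posSemidef_real_iff.1 hk
  have hk0 : ∀ a b, 0 ≤ k a b := fun a b => (Real.exp_pos _).le
  have hk1 : ∀ a b, k a b ≤ 1 := fun a b => Real.exp_le_one_iff.2 (neg_nonpos.2 (hN0 _))
  have hkabs : ∀ a b, |k a b| ≤ 1 := fun a b => by
    rw [abs_of_nonneg (hk0 a b)]
    exact hk1 a b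
  have hmconst : ∀ c : ℝ, m (fun _ => c) = c := fun c => by
    have := m.map_smul c (fun _ => 1)
    rw [hm1] at this
    simpa [Pi.smul_def] using this
  have hmono : ∀ f₁ f₂ : G → ℝ, (∃ C, ∀ x, |f₁ x| ≤ C) → (∃ C, ∀ x, |f₂ x| ≤ C) →
      (∀ x, f₁ x ≤ f₂ x) → m f₁ ≤ m f₂ := by
    rintro f₁ f₂ ⟨C₁, h₁⟩ ⟨C₂, h₂⟩ h
    have := hmpos (f₂ - f₁) (C₂ + C₁)
      (fun x => (abs_sub _ _).trans (add_le_add (h₂ x) (h₁ x))) fun x => sub_nonneg.2 (h x)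
    rw [map_sub] at this
    linarith
  let ψ : G → ℝ := fun g => m fun h => k (g * h) h
  have hψ : ∀ a b, ψ (a * b⁻¹) = m fun h => k (a * h) (b * h) := by
    intro a b
    have := hminv b (fun h => k (a * b⁻¹ * h) h) 1 fun x => hkabs _ _
    simp only [inv_mul_cancel_left, mul_assoc] at this
    simp only [ψ, mul_assoc]
    exact this.symm
  have hψle : ∀ g, ψ g ≤ 1 := fun g =>
    (hmono _ _ ⟨1, fun _ => hkabs _ _⟩ ⟨1, by simp⟩ fun h => hk1 _ _).trans_eq hm1
  refine ⟨ψ, ?_, posSemidef_real_iff.2 ⟨fun a b => ?_, fun F c => ?_⟩, ?_,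
    1 - Real.exp (-ε), sub_pos.2 (by simpa using hε), fun g hg => ?_⟩
  · have : ∀ h, k (1 * h) h = 1 := fun h => by simp [k, hNz]
    simp only [ψ, this, hm1]
  · simp only [Matrix.of_apply, hψ]
    simp_rw [hk'.1 (a * _)]
  · have : ∑ a ∈ F, ∑ b ∈ F, c a * c b * ψ (a * b⁻¹) =
        m (∑ a ∈ F, ∑ b ∈ F, (c a * c b) • fun h => k (a * h) (b * h)) := by
      simp only [map_sum, map_smul, smul_eq_mul, hψ]
    simp only [Matrix.of_apply]
    rw [this]
    refine hmpos _ (∑ a ∈ F, ∑ b ∈ F, |c a * c b|) (fun x => ?_) fun x => ?_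
    · simp only [Finset.sum_apply, Pi.smul_apply, smul_eq_mul]
      refine (Finset.abs_sum_le_sum_abs _ _).trans (Finset.sum_le_sum fun a _ =>
        (Finset.abs_sum_le_sum_abs _ _).trans (Finset.sum_le_sum fun b _ => ?_))
      rw [abs_mul]
      exact mul_le_of_le_one_right (abs_nonneg _) (hkabs _ _)
    · simp only [Finset.sum_apply, Pi.smul_apply, smul_eq_mul]
      exact (posSemidef_real_iff.1 (hk.submatrix (· * x))).2 F c
  · have hψ1 : ψ 1 = 1 := by
      have : ∀ h, k (1 * h) h = 1 := fun h => by simp [k, hNz]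
      simp only [ψ, this, hm1]
    rw [ContinuousAt, hψ1, Metric.tendsto_nhds]
    intro r hr
    filter_upwards [hin K' hK' (r / 4) (by positivity)] with u hu
    have h1 : 1 - r / 2 ≤ ψ u := by
      rw [← hmconst (1 - r / 2)]
      refine hmono _ _ ⟨_, fun _ => le_rfl⟩ ⟨1, fun _ => hkabs _ _⟩ fun h => ?_
      have h2 : N (η (u * h) - η h) ≤ 2 * (r / 4) := hN2 _ _ (hu h)
      have h3 := Real.add_one_le_exp (-N (η (u * h) - η h))
      simp only [k, Matrix.of_apply]
      linarith
    rw [Real.dist_eq, abs_sub_lt_iff]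
    constructor <;> linarith [hψle u]
  · by_contra hgU
    have : ψ g ≤ Real.exp (-ε) := by
      rw [← hmconst (Real.exp (-ε))]
      refine hmono _ _ ⟨1, fun _ => hkabs _ _⟩ ⟨_, fun _ => le_rfl⟩ fun h => ?_
      by_contra! hcon
      have h1 : N (η (g * h) - η h) < ε := by
        simpa [k] using hcon
      refine hgU ?_
      simpa using hKU (g * h) h fun f hf => (hN1 _ f hf).trans_lt h1
    linarith

end Averaging

/-- An integrable function on a compact Hausdorff space with a regular measure is determined by its
integrals against continuous functions. -/
theorem L1TauK.toDual_injective {X : Type*} [TopologicalSpace X] [CompactSpace X]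
    [MeasurableSpace X] [BorelSpace X] [T2Space X] (μ : Measure X) [μ.Regular]
    {f : L1TauK μ} (hf : L1TauK.toDual μ f = 0) : f = 0 := by
  let F : Lp ℂ 1 μ := f
  have hF : Integrable F μ := L1.integrable_coeFn F
  have hFg : ∀ g : C(X, ℂ), ∫ x, F x * g x ∂μ = 0 := fun g => DFunLike.congr_fun hf g
  have hclosed : ∀ s : Set X, IsClosed s → ∫ x in s, F x ∂μ = 0 := by
    intro s hs
    refine norm_le_zero_iff.1 (le_of_forall_pos_le_add fun ε hε => ?_)
    obtain ⟨δ, hδ, hδε⟩ := exists_pos_setLIntegral_lt_of_measure_lt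
      (μ := μ) (f := fun x => ‖F x‖ₑ) hF.2.ne (ENNReal.ofReal_pos.2 hε).ne'
    obtain ⟨V, hsV, hV, hμV⟩ := s.exists_isOpen_lt_add (measure_ne_top μ s) hδ.ne'
    have hμ : μ (V \ s) < δ := measure_sdiff_lt_of_lt_add hs.measurableSet.nullMeasurableSet hsV
      (measure_ne_top μ s) hμV
    obtain ⟨g, hg0, hg1, hg⟩ := exists_continuous_zero_one_of_isClosed hV.isClosed_compl hs
      (Set.disjoint_compl_left_iff_subset.2 hsV)
    let g' : C(X, ℂ) := ⟨fun x => (g x : ℂ), by fun_prop⟩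
    have hint : ∫ x in s, F x ∂μ = ∫ x, (s.indicator F x - F x * g' x) ∂μ := by
      rw [integral_sub (hF.indicator hs.measurableSet) (L1TauK.integrable_mul μ F g'), hFg,
        sub_zero, integral_indicator hs.measurableSet]
    have hptw : ∀ x, ‖s.indicator F x - F x * g' x‖ ≤ (V \ s).indicator (fun x => ‖F x‖) x := by
      intro x
      by_cases hxs : x ∈ s
      · simp [hxs, g', hg1 hxs]
      · by_cases hxV : x ∈ V
        · simp only [hxs, not_false_eq_true, Set.indicator_of_notMem, zero_sub, norm_neg,
            norm_mul, Set.mem_sdiff, hxV, and_self, Set.indicator_of_mem]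
          refine mul_le_of_le_one_right (norm_nonneg _) ?_
          simp only [g', ContinuousMap.coe_mk, Complex.norm_real]
          rw [Real.norm_of_nonneg (hg x).1]
          exact (hg x).2
        · have : g x = 0 := hg0 hxV
          simp [hxs, hxV, g', this]
    have hmeas : MeasurableSet (V \ s) := hV.measurableSet.diff hs.measurableSet
    rw [hint, zero_add]
    refine (norm_integral_le_of_norm_le (hF.norm.indicator hmeas)
      (Filter.Eventually.of_forall hptw)).trans ?_
    rw [integral_indicator hmeas, integral_norm_eq_lintegral_enorm hF.1.restrict]
    exact ENNReal.toReal_le_of_le_ofReal hε.le (hδε _ hμ).le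
  have h0 : F =ᵐ[μ] 0 := ae_eq_zero_of_forall_setIntegral_isClosed_eq_zero hF
    fun s hs => hclosed s hs
  exact (Lp.eq_zero_iff_ae_eq_zero (f := F)).2 h0

theorem L1TauK.t0Space {X : Type*} [TopologicalSpace X] [CompactSpace X]
    [MeasurableSpace X] [BorelSpace X] [T2Space X] (μ : Measure X) [μ.Regular] :
    T0Space (L1TauK μ) := by
  refine t0Space_iff_uniformity.2 fun f₁ f₂ h => sub_eq_zero.1 (L1TauK.toDual_injective μ ?_)
  have heq : ∀ g, L1TauK.toDual μ f₁ g = L1TauK.toDual μ f₂ g := fun g =>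
    dist_le_zero.1 (le_of_forall_pos_le_add fun ε hε => by
      rw [zero_add]
      exact (h _ ((L1TauK.hasBasis_uniformity μ).mem_of_mem (i := (({g} : Set C(X, ℂ)), ε))
        ⟨isCompact_singleton, hε⟩) g (Set.mem_singleton g)).le)
  have hadd : L1TauK.toDual μ (f₁ - f₂) + L1TauK.toDual μ f₂ = L1TauK.toDual μ f₁ := by
    ext g
    have := congrFun (congrArg (UniformOnFun.toFun _) (L1TauK.pairing_add μ (f₁ - f₂) f₂)) g
    rw [sub_add_cancel] at this
    exact this.symm
  ext g
  have := DFunLike.congr_fun hadd g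
  rw [add_apply, heq g] at this
  simpa using this

/-- `hG` says that `G` is Hausdorff, as every unitarily representable group is, or that `X` is
Hausdorff and `μ` is regular, in which case `G` is Hausdorff as well. -/
theorem corollary3p4 {G : Type*} [CommGroup G] [TopologicalSpace G] [IsTopologicalGroup G]
    {X : Type*} [TopologicalSpace X] [CompactSpace X] [MeasurableSpace X] [BorelSpace X]
    (μ : Measure X) (hG : T2Space G ∨ (T2Space X ∧ μ.Regular))
    (hT : ∃ T : G → L1TauK μ,
      @IsUniformEmbedding G (L1TauK μ) (IsTopologicalGroup.rightUniformSpace G) inferInstance T) :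
    IsUnitarilyRepresentable G := by
  obtain ⟨T, hT⟩ := hT
  have hT0 : T0Space G := by
    rcases hG with hG | ⟨hX, hμ⟩
    · infer_instance
    · have := L1TauK.t0Space μ
      let _ : UniformSpace G := IsTopologicalGroup.rightUniformSpace G
      exact hT.isEmbedding.t0Space
  exact isUnitarilyRepresentable_of_posSemidef fun U hU =>
    exists_posDef_of_isUniformEmbedding μ hT hU
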